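/- For a positive integer $n$, let $\binom{[n]}{2}$ be the set of two-element subsets (edges) of $[n]=\{1,\dots,n\}$. A square is a four-edge set $\{\{a,b\},\{b,c\},\{c,d\},\{d,a\}\}\subseteq\binom{[n]}{2}$ with $a,b,c,d$ distinct; an edge set is square-free if it contains no square. For $\varepsilon\in(0,1)$, a probability distribution $\mu$ on $\binom{[n]}{2}$ is called $\varepsilon$-far from square-free if $\mu\big(\binom{[n]}{2}\setminus E\big)\ge\varepsilon$ for every square-free $E\subseteq\binom{[n]}{2}$. There is an absolute constant $C>0$ such that the following holds for every positive integer $n$, every $\varepsilon\in(0,1)$ and every probability distribution $\mu$ on $\binom{[n]}{2}$ that is $\varepsilon$-far from square-free: for every integer $m\ge C\,n^{9/8}/\varepsilon$, among $m$ independent samples from $\mu$, with probability at least $2/3$ there exist four sampled pairs $\{a,b\},\{b,c\},\{c,d\},\{d,a\}$, with $a,b,c,d$ distinct, forming a square. -/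

import Mathlib

open MeasureTheory

namespace EdgeDist

/-- The edges on the vertex set `[n]`: unordered pairs of distinct elements of `Fin n`. -/
def Edge (n : ℕ) : Type := {e : Sym2 (Fin n) // ¬ e.IsDiag}

instance (n : ℕ) : DecidableEq (Edge n) :=
  inferInstanceAs (DecidableEq {e : Sym2 (Fin n) // ¬ e.IsDiag})

instance (n : ℕ) : Fintype (Edge n) :=
  inferInstanceAs (Fintype {e : Sym2 (Fin n) // ¬ e.IsDiag})

/-- The finite set of edges carries the discrete σ-algebra. -/
instance (n : ℕ) : MeasurableSpace (Edge n) := ⊤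

instance (n : ℕ) : DiscreteMeasurableSpace (Edge n) := ⟨fun _ => trivial⟩

/-- `e` is the edge `{a, b}`. -/
def Edge.Joins {n : ℕ} (e : Edge n) (a b : Fin n) : Prop := e.val = s(a, b)

/-- The squares on `[n]`: the edge sets `{{a, b}, {b, c}, {c, d}, {d, a}}` with `a, b, c, d`
distinct. -/
def squares (n : ℕ) : Set (Set (Edge n)) :=
  {Q | ∃ a b c d : Fin n, a ≠ b ∧ a ≠ c ∧ a ≠ d ∧ b ≠ c ∧ b ≠ d ∧ c ≠ d ∧
    Q = {e | e.Joins a b ∨ e.Joins b c ∨ e.Joins c d ∨ e.Joins d a}}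

/-- An edge set is square-free if it contains no square. -/
def SquareFree {n : ℕ} (E : Set (Edge n)) : Prop := ∀ Q ∈ squares n, ¬ Q ⊆ E

/-- `μ` is `ε`-far from square-free: every square-free edge set misses `μ`-mass at least `ε`. -/
def FarFromSquareFree {n : ℕ} (ε : ℝ) (μ : Measure (Edge n)) : Prop :=
  ∀ E : Set (Edge n), SquareFree E → ε ≤ μ.real Eᶜ

/-- The event, for a sequence of `m` sampled edges, that all four edges of some square are
sampled. -/
def squareSampled (n m : ℕ) : Set (Fin m → Edge n) :=
  {x | ∃ Q ∈ squares n, Q ⊆ Set.range x}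

end EdgeDist

/-! Poissonise: with a Poisson number of samples of mean m/2, edges appear independently, at the
cost of a factor 2 in the failure probability (`sampleProb_le_two_mul`). Split each edge into eight
independent copies, four colours times two orientations, and look for a square whose i-th edge has
colour i. Two coloured tuples can only share elements place by place, so joint probabilities factor.

Let y be the intensity of one copy. Greedily removing squares gives a fractional packing Λ of
squares into y that leaves only a square-free support, so farness forces its total to be at least
mε/64 (`exists_packing`). Call an edge light when y ≤ θ.

If at least half of Λ lies on squares without light edges, the second moment method with weights
Λ/∏p bounds the failure probability by O(θ⁻³ / total) (`coloured_packing`). Otherwise the expected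
number T of light edges is at least of the order of the total, and a random graph with edge
probabilities at most θ is likely to contain a square once T is large against both n and n^{3/2}θ
(`coloured_light`). There a four-cycle abcd is weighted by the reciprocal codegree of a and c, which
controls the variance however irregular the graph is. The choice θ = n^{-3/8} balances the cases:
θ⁻³ and n^{3/2}θ both equal n^{9/8}. -/

namespace EdgeDist

/-! ### Random subsets with independent elements -/

section RandomSubset

variable {τ : Type*} [Fintype τ] [DecidableEq τ]

/-- The probability of `S` when every `t` is chosen independently with probability `p t`. -/
noncomputable def subsetWeight (p : τ → ℝ) (S : Finset τ) : ℝ :=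
  (∏ t ∈ S, p t) * ∏ t ∈ Sᶜ, (1 - p t)

/-- The expectation of `φ` over a random subset with independent elements. -/
noncomputable def subsetExp (p : τ → ℝ) (φ : Finset τ → ℝ) : ℝ :=
  ∑ S, subsetWeight p S * φ S

lemma subsetWeight_nonneg {p : τ → ℝ} (h0 : ∀ t, 0 ≤ p t) (h1 : ∀ t, p t ≤ 1) (S : Finset τ) :
    0 ≤ subsetWeight p S :=
  mul_nonneg (Finset.prod_nonneg fun t _ => h0 t)
    (Finset.prod_nonneg fun t _ => sub_nonneg.2 (h1 t))

/-- Expand ∏ (p t + (1 - p t)) over subsets; replacing 1 - p t by 0 on I kills exactly the subsets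
that miss an element of I. -/
lemma subsetExp_superset (p : τ → ℝ) (I : Finset τ) :
    subsetExp p (fun S => if I ⊆ S then 1 else 0) = ∏ t ∈ I, p t := by
  have h := Finset.prod_add p (fun t => if t ∈ I then 0 else 1 - p t) Finset.univ
  have h1 : ∏ t, (p t + if t ∈ I then 0 else 1 - p t) = ∏ t ∈ I, p t := by
    rw [← Finset.prod_subset (Finset.subset_univ I)]
    · exact Finset.prod_congr rfl fun t ht => by simp [ht]
    · intro t _ ht
      simp [ht]
  rw [← h1, h, subsetExp, Finset.powerset_univ]
  refine Finset.sum_congr rfl fun S _ => ?_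
  rw [subsetWeight, mul_assoc, ← Finset.compl_eq_univ_sdiff]
  congr 1
  split_ifs with hI
  · rw [mul_one]
    exact Finset.prod_congr rfl fun t ht => by
      rw [if_neg fun h => Finset.mem_compl.1 ht (hI h)]
  · obtain ⟨t, htI, htS⟩ := Finset.not_subset.1 hI
    rw [mul_zero, Finset.prod_eq_zero (Finset.mem_compl.2 htS)]
    simp [htI]

lemma subsetExp_disjoint (p : τ → ℝ) (J : Finset τ) :
    subsetExp p (fun S => if Disjoint S J then 1 else 0) = ∏ t ∈ J, (1 - p t) := by
  have h := Finset.prod_add (fun t => if t ∈ J then 0 else p t) (fun t => 1 - p t) Finset.univ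
  have h1 : ∏ t, ((if t ∈ J then 0 else p t) + (1 - p t)) = ∏ t ∈ J, (1 - p t) := by
    rw [← Finset.prod_subset (Finset.subset_univ J)]
    · exact Finset.prod_congr rfl fun t ht => by simp [ht]
    · intro t _ ht
      simp [ht]
  rw [← h1, h, subsetExp, Finset.powerset_univ]
  refine Finset.sum_congr rfl fun S _ => ?_
  rw [subsetWeight, mul_right_comm, ← Finset.compl_eq_univ_sdiff]
  congr 1
  split_ifs with hJ
  · rw [mul_one]
    exact Finset.prod_congr rfl fun t ht => by
      rw [if_neg (Finset.disjoint_left.1 hJ ht)]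
  · obtain ⟨t, htS, htJ⟩ := Finset.not_disjoint_iff.1 hJ
    rw [mul_zero, Finset.prod_eq_zero htS]
    simp [htJ]

lemma subsetExp_const (p : τ → ℝ) (c : ℝ) : subsetExp p (fun _ => c) = c := by
  have h := subsetExp_superset p ∅
  simp only [Finset.empty_subset, if_true, Finset.prod_empty, subsetExp, mul_one] at h
  rw [subsetExp, ← Finset.sum_mul, h, one_mul]

/-- Second moment method for a weighted count of the sets `I j` inside a random subset. -/
lemma subsetExp_mul_sq_le {ι : Type*} [Fintype ι] {p : τ → ℝ} (h0 : ∀ t, 0 ≤ p t)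
    (h1 : ∀ t, p t ≤ 1) (I : ι → Finset τ) (w : ι → ℝ) (F : Finset τ → Prop) [DecidablePred F]
    (hF : ∀ S, F S → ∀ j, w j ≠ 0 → ¬ I j ⊆ S) :
    subsetExp p (fun S => if F S then 1 else 0) * (∑ j, w j * ∏ t ∈ I j, p t) ^ 2 ≤
      ∑ j, ∑ k, w j * w k * (∏ t ∈ I j ∪ I k, p t - (∏ t ∈ I j, p t) * ∏ t ∈ I k, p t) := by
  set M := ∑ j, w j * ∏ t ∈ I j, p t with hM
  set X : Finset τ → ℝ := fun S => ∑ j, w j * if I j ⊆ S then 1 else 0 with hX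
  have hEX : subsetExp p X = M := by
    rw [hM]
    simp_rw [← subsetExp_superset, subsetExp, hX, Finset.mul_sum]
    rw [Finset.sum_comm]
    exact Finset.sum_congr rfl fun j _ => Finset.sum_congr rfl fun S _ => by ring
  have hEX2 : subsetExp p (fun S => X S ^ 2) = ∑ j, ∑ k, w j * w k * ∏ t ∈ I j ∪ I k, p t := by
    simp_rw [← subsetExp_superset, subsetExp, hX, sq, Finset.sum_mul_sum, Finset.mul_sum]
    rw [Finset.sum_comm]
    refine Finset.sum_congr rfl fun j _ => ?_
    rw [Finset.sum_comm]
    refine Finset.sum_congr rfl fun k _ => Finset.sum_congr rfl fun S _ => ?_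
    simp only [Finset.union_subset_iff, ite_and]
    split_ifs <;> ring
  have hlin : subsetExp p (fun S => (X S - M) ^ 2) =
      subsetExp p (fun S => X S ^ 2) - M ^ 2 := by
    have : subsetExp p (fun S => (X S - M) ^ 2) =
        subsetExp p (fun S => X S ^ 2) - 2 * M * subsetExp p X + subsetExp p (fun _ => M ^ 2) := by
      simp only [subsetExp, Finset.mul_sum, ← Finset.sum_sub_distrib, ← Finset.sum_add_distrib]
      exact Finset.sum_congr rfl fun S _ => by ring
    rw [this, hEX, subsetExp_const]
    ring
  -- Chebyshev: on F the count X vanishes, so (X - M)² equals M² there.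
  have hle : subsetExp p (fun S => if F S then 1 else 0) * M ^ 2 ≤
      subsetExp p (fun S => (X S - M) ^ 2) := by
    rw [subsetExp, Finset.sum_mul]
    refine Finset.sum_le_sum fun S _ => ?_
    rw [mul_assoc]
    refine mul_le_mul_of_nonneg_left ?_ (subsetWeight_nonneg h0 h1 S)
    split_ifs with hS
    · have : X S = 0 := Finset.sum_eq_zero fun j _ => by
        by_cases hw : w j = 0
        · simp [hw]
        · simp [hF S hS j hw]
      simp [this]
    · nlinarith [sq_nonneg (X S - M)]
  refine hle.trans_eq ?_
  rw [hlin, hEX2, hM, sq, Finset.sum_mul_sum, ← Finset.sum_sub_distrib]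
  refine Finset.sum_congr rfl fun j _ => ?_
  rw [← Finset.sum_sub_distrib]
  exact Finset.sum_congr rfl fun k _ => by ring

end RandomSubset

/-! ### Coloured tuples and the heavy case -/

section Coloured

variable {α ι : Type*} [Fintype α] [DecidableEq α] [Fintype ι]

/-- Second moment method for coloured four-tuples: element `i` of the tuple `q j` has to be chosen
in the `i`-th of four independent random subsets of `α`. -/
lemma coloured_second_moment {p : α → ℝ} (h0 : ∀ t, 0 ≤ p t)
    (h1 : ∀ t, p t ≤ 1) (q : ι → Fin 4 → α) (w : ι → ℝ)
    (F : Finset (Σ _ : Fin 4, α) → Prop) [DecidablePred F]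
    (hF : ∀ S, F S → ∀ j, w j ≠ 0 → ∃ i, ⟨i, q j i⟩ ∉ S) :
    subsetExp (fun t : Σ _ : Fin 4, α => p t.2) (fun S => if F S then 1 else 0) *
        (∑ j, w j * ∏ i, p (q j i)) ^ 2 ≤
      ∑ j, ∑ k, w j * w k * ((∏ i, p (q j i)) *
        (∏ i, (if q j i = q k i then 1 else p (q k i)) - ∏ i, p (q k i))) := by
  have hI : ∀ j, ∏ t ∈ Finset.univ.sigma (fun i => ({q j i} : Finset α)), p t.2 =
      ∏ i, p (q j i) := fun j => by
    rw [Finset.prod_sigma]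
    simp
  have hU : ∀ j k, ∏ t ∈ Finset.univ.sigma (fun i => ({q j i} : Finset α)) ∪
      Finset.univ.sigma (fun i => ({q k i} : Finset α)), p t.2 =
      (∏ i, p (q j i)) * ∏ i, (if q j i = q k i then 1 else p (q k i)) := fun j k => by
    have : Finset.univ.sigma (fun i => ({q j i} : Finset α)) ∪
      Finset.univ.sigma (fun i => ({q k i} : Finset α)) =
        Finset.univ.sigma (fun i => ({q j i, q k i} : Finset α)) := by
      ext ⟨i, e⟩
      simp
    rw [this, Finset.prod_sigma, ← Finset.prod_mul_distrib]
    refine Finset.prod_congr rfl fun i _ => ?_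
    split_ifs with h
    · simp [h]
    · simp [Finset.prod_pair h]
  have := subsetExp_mul_sq_le (p := fun t : Σ _ : Fin 4, α => p t.2) (fun t => h0 _)
    (fun t => h1 _) (fun j => Finset.univ.sigma (fun i => ({q j i} : Finset α))) w F
    (fun S hS j hw hsub => by
      obtain ⟨i, hi⟩ := hF S hS j hw
      exact hi (hsub (by simp)))
  simp only [hI, hU] at this
  refine this.trans_eq ?_
  exact Finset.sum_congr rfl fun j _ => Finset.sum_congr rfl fun k _ => by ring

/-- Telescoping: each difference r i - 1 is multiplied by the product of the later factors, at most
three of them. -/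
lemma prod_four_sub_one_le {B : ℝ} (hB : 1 ≤ B) (r : Fin 4 → ℝ) (h1 : ∀ i, 1 ≤ r i)
    (hr : ∀ i, r i ≤ B) : ∏ i, r i - 1 ≤ B ^ 3 * ∑ i, (r i - 1) := by
  rw [Fin.prod_univ_four, Fin.sum_univ_four]
  have hB1 : B ≤ B ^ 3 := le_self_pow₀ hB (by norm_num)
  have hB2 : B ^ 2 ≤ B ^ 3 := pow_le_pow_right₀ hB (by norm_num)
  have hB0 : 1 ≤ B ^ 3 := one_le_pow₀ hB
  have e3 : r 3 ≤ B ^ 3 := (hr 3).trans hB1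
  have p2 : 0 ≤ r 2 := by linarith [h1 2]
  have p3 : 0 ≤ r 3 := by linarith [h1 3]
  have e2' : r 2 * r 3 ≤ B ^ 2 := by
    rw [sq]; exact mul_le_mul (hr 2) (hr 3) p3 (by linarith)
  have e2 : r 2 * r 3 ≤ B ^ 3 := e2'.trans hB2
  have e1 : r 1 * (r 2 * r 3) ≤ B ^ 3 := by
    calc r 1 * (r 2 * r 3) ≤ B * B ^ 2 :=
          mul_le_mul (hr 1) e2' (mul_nonneg p2 p3) (by linarith)
      _ = B ^ 3 := by ring
  have a0 := mul_le_mul_of_nonneg_left e1 (sub_nonneg.2 (h1 0))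
  have a1 := mul_le_mul_of_nonneg_left e2 (sub_nonneg.2 (h1 1))
  have a2 := mul_le_mul_of_nonneg_left e3 (sub_nonneg.2 (h1 2))
  have a3 := mul_le_mul_of_nonneg_left hB0 (sub_nonneg.2 (h1 3))
  linarith

/-- If a family of coloured four-tuples carries a weight `Λ` whose load on each element is at most
`y`, and each element that occurs is chosen with probability `1 - exp (-y) ≥ B⁻¹`, then it is
unlikely that no tuple is chosen completely. -/
lemma coloured_packing {y : α → ℝ} (hy : ∀ e, 0 ≤ y e) (q : ι → Fin 4 → α) (Λ : ι → ℝ)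
    (hΛ : ∀ j, 0 ≤ Λ j) (hload : ∀ i e, ∑ j, (if q j i = e then Λ j else 0) ≤ y e)
    {B : ℝ} (hB : 1 ≤ B) (hp : ∀ j, Λ j ≠ 0 → ∀ i, B⁻¹ ≤ 1 - Real.exp (-y (q j i)))
    (F : Finset (Σ _ : Fin 4, α) → Prop) [DecidablePred F]
    (hF : ∀ S, F S → ∀ j, Λ j ≠ 0 → ∃ i, ⟨i, q j i⟩ ∉ S) :
    subsetExp (fun t : Σ _ : Fin 4, α => 1 - Real.exp (-y t.2)) (fun S => if F S then 1 else 0) *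
        (∑ j, Λ j) ^ 2 ≤ 4 * B ^ 3 * ∑ j, Λ j := by
  set p : α → ℝ := fun e => 1 - Real.exp (-y e) with hpdef
  have h0 : ∀ e, 0 ≤ p e := fun e => by
    have : Real.exp (-y e) ≤ 1 := Real.exp_le_one_iff.2 (by linarith [hy e])
    simp only [hpdef]; linarith
  have h1 : ∀ e, p e ≤ 1 := fun e => by
    have := Real.exp_pos (-y e)
    simp only [hpdef]; linarith
  have hBpos : 0 < B⁻¹ := inv_pos.2 (by linarith)
  have hpp : ∀ j, Λ j ≠ 0 → ∀ i, 0 < p (q j i) := fun j hj i => hBpos.trans_le (hp j hj i)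
  -- Dividing by the probability of the tuple makes the expected weighted count equal to ∑ Λ.
  have key := coloured_second_moment h0 h1 q (fun j => Λ j / ∏ i, p (q j i)) F
    (fun S hS j hw => hF S hS j fun h => hw (by simp [h]))
  have hM : ∑ j, Λ j / (∏ i, p (q j i)) * ∏ i, p (q j i) = ∑ j, Λ j := by
    refine Finset.sum_congr rfl fun j _ => ?_
    by_cases hj : Λ j = 0
    · simp [hj]
    · exact div_mul_cancel₀ _ (Finset.prod_pos fun i _ => hpp j hj i).ne'
  rw [hM] at key
  refine key.trans ?_
  -- With p = 1 - exp (-y) this is y ≤ exp y - 1. It absorbs the load, which may be as large as y: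
  -- elements of large y are almost surely chosen and hardly correlate tuples.
  have hz : ∀ j, Λ j ≠ 0 → ∀ i, ((p (q j i))⁻¹ - 1) * y (q j i) ≤ 1 := fun j hj i => by
    have hpos := hpp j hj i
    have h2 : (p (q j i))⁻¹ - 1 = Real.exp (-y (q j i)) / p (q j i) := by
      field_simp
      simp only [hpdef]; ring
    rw [h2, div_mul_eq_mul_div, div_le_one hpos]
    have h3 := Real.add_one_le_exp (y (q j i))
    have h4 : Real.exp (-y (q j i)) * Real.exp (y (q j i)) = 1 := by
      rw [← Real.exp_add]; simp
    have h5 := Real.exp_pos (-y (q j i))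
    simp only [hpdef]
    nlinarith
  have hterm : ∀ j k, Λ j / (∏ i, p (q j i)) * (Λ k / ∏ i, p (q k i)) * ((∏ i, p (q j i)) *
        (∏ i, (if q j i = q k i then 1 else p (q k i)) - ∏ i, p (q k i))) ≤
      B ^ 3 * ∑ i, (if q j i = q k i then Λ j else 0) * (Λ k * ((p (q k i))⁻¹ - 1)) := by
    intro j k
    by_cases hj : Λ j = 0
    · simp [hj]
    by_cases hk : Λ k = 0
    · simp [hk]
    have hPj : 0 < ∏ i, p (q j i) := Finset.prod_pos fun i _ => hpp j hj i
    have hPk : 0 < ∏ i, p (q k i) := Finset.prod_pos fun i _ => hpp k hk i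
    have e1 : Λ j / (∏ i, p (q j i)) * (Λ k / ∏ i, p (q k i)) * ((∏ i, p (q j i)) *
        (∏ i, (if q j i = q k i then 1 else p (q k i)) - ∏ i, p (q k i))) =
        Λ j * Λ k * (∏ i, (if q j i = q k i then (p (q k i))⁻¹ else 1) - 1) := by
      have : ∏ i, (if q j i = q k i then (p (q k i))⁻¹ else 1) =
          (∏ i, (if q j i = q k i then 1 else p (q k i))) / ∏ i, p (q k i) := by
        rw [← Finset.prod_div_distrib]
        refine Finset.prod_congr rfl fun i _ => ?_
        have := (hpp k hk i).ne'
        split_ifs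
        · rw [one_div]
        · rw [div_self this]
      rw [this]
      field_simp
    rw [e1]
    have e2 := prod_four_sub_one_le hB (fun i => if q j i = q k i then (p (q k i))⁻¹ else 1)
      (fun i => by
        split_ifs
        · exact (one_le_inv₀ (hpp k hk i)).2 (h1 _)
        · exact le_rfl)
      (fun i => by
        split_ifs
        · exact inv_le_of_inv_le₀ (by linarith) (hp k hk i)
        · exact hB)
    refine (mul_le_mul_of_nonneg_left e2 (mul_nonneg (hΛ j) (hΛ k))).trans_eq ?_
    rw [mul_left_comm, Finset.mul_sum]
    congr 1
    refine Finset.sum_congr rfl fun i _ => ?_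
    split_ifs <;> ring
  refine (Finset.sum_le_sum fun j _ => Finset.sum_le_sum fun k _ => hterm j k).trans ?_
  simp_rw [← Finset.mul_sum]
  rw [mul_assoc 4, mul_left_comm 4]
  refine mul_le_mul_of_nonneg_left ?_ (by positivity)
  have hsw : ∑ j, ∑ k, ∑ i, (if q j i = q k i then Λ j else 0) * (Λ k * ((p (q k i))⁻¹ - 1)) =
      ∑ i : Fin 4, ∑ k, (∑ j, if q j i = q k i then Λ j else 0) * (Λ k * ((p (q k i))⁻¹ - 1)) := by
    rw [Finset.sum_comm]
    simp_rw [Finset.sum_comm (s := (Finset.univ : Finset ι)) (t := (Finset.univ : Finset (Fin 4)))]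
    refine Finset.sum_congr rfl fun i _ => Finset.sum_congr rfl fun k _ => ?_
    rw [Finset.sum_mul]
  rw [hsw]
  have hi : ∀ i : Fin 4, ∑ k, (∑ j, if q j i = q k i then Λ j else 0) *
      (Λ k * ((p (q k i))⁻¹ - 1)) ≤ ∑ k, Λ k := fun i => by
    refine Finset.sum_le_sum fun k _ => ?_
    by_cases hk : Λ k = 0
    · simp [hk]
    have hinv : 0 ≤ (p (q k i))⁻¹ - 1 := sub_nonneg.2 ((one_le_inv₀ (hpp k hk i)).2 (h1 _))
    calc _ ≤ y (q k i) * (Λ k * ((p (q k i))⁻¹ - 1)) :=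
          mul_le_mul_of_nonneg_right (hload i _) (mul_nonneg (hΛ k) hinv)
      _ = Λ k * (((p (q k i))⁻¹ - 1) * y (q k i)) := by ring
      _ ≤ Λ k * 1 := mul_le_mul_of_nonneg_left (hz k hk i) (hΛ k)
      _ = Λ k := mul_one _
  calc _ ≤ ∑ _i : Fin 4, ∑ k, Λ k := Finset.sum_le_sum fun i _ => hi i
    _ = 4 * ∑ k, Λ k := by simp

end Coloured

/-! ### Four-cycles weighted by reciprocal codegree -/

section Kernel

variable {V : Type*} [Fintype V]

/-- The weighted number of paths of length two from `a` to `c`. -/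
noncomputable def codeg (q : V → V → ℝ) (a c : V) : ℝ := ∑ b, q a b * q b c

/-- The reciprocal of the codegree at pairs of distinct vertices of codegree at least `κ`, and `0`
elsewhere. -/
noncomputable def codegInv [DecidableEq V] (q : V → V → ℝ) (κ : ℝ) (a c : V) : ℝ :=
  if a ≠ c ∧ κ ≤ codeg q a c then (codeg q a c)⁻¹ else 0

variable {q : V → V → ℝ} {κ θ D : ℝ}

lemma codeg_nonneg (h0 : ∀ u v, 0 ≤ q u v) (a c : V) : 0 ≤ codeg q a c :=
  Finset.sum_nonneg fun _ _ => mul_nonneg (h0 _ _) (h0 _ _)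

lemma codeg_comm (hs : ∀ u v, q u v = q v u) (a c : V) : codeg q a c = codeg q c a :=
  Finset.sum_congr rfl fun b _ => by rw [hs a b, hs b c, mul_comm]

lemma codegInv_nonneg [DecidableEq V] (h0 : ∀ u v, 0 ≤ q u v) (a c : V) : 0 ≤ codegInv q κ a c := by
  unfold codegInv
  split_ifs
  · exact inv_nonneg.2 (codeg_nonneg h0 a c)
  · exact le_rfl

lemma codegInv_le [DecidableEq V] (hκ : 0 < κ) (a c : V) : codegInv q κ a c ≤ κ⁻¹ := by
  unfold codegInv
  split_ifs with h
  · exact inv_anti₀ hκ h.2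
  · exact inv_nonneg.2 hκ.le

lemma codegInv_mul_codeg_le [DecidableEq V] (a c : V) : codegInv q κ a c * codeg q a c ≤ 1 := by
  unfold codegInv
  split_ifs with h
  · by_cases h0 : codeg q a c = 0
    · simp [h0]
    · rw [inv_mul_cancel₀ h0]
  · simp

lemma sum_codeg (hs : ∀ u v, q u v = q v u) :
    ∑ a, ∑ c, codeg q a c = ∑ b, (∑ a, q b a) ^ 2 := by
  unfold codeg
  simp_rw [Finset.sum_comm (s := (Finset.univ : Finset V)) (t := (Finset.univ : Finset V))
    (f := fun c b => q _ b * q b c)]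
  rw [Finset.sum_comm]
  refine Finset.sum_congr rfl fun b _ => ?_
  rw [sq, Finset.sum_mul_sum]
  simp_rw [hs _ b]

/-- The expected number of four-cycles, counted with weight `codegInv`, is a constant proportion of
the expected number of paths of length two. -/
lemma le_sum_codegInv_mul [DecidableEq V] [Nonempty V] (h0 : ∀ u v, 0 ≤ q u v) (hs : ∀ u v, q u v = q v u)
    (hθ : ∀ u v, q u v ≤ θ) {W : ℝ} (hW : W = ∑ a, ∑ c, codeg q a c) (hWpos : 0 < W)
    (h1 : 8 * (Fintype.card V : ℝ) ^ 2 * θ ^ 2 ≤ W) (h2 : 4 * (θ * ∑ a, ∑ b, q a b) ≤ W)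
    (hκ : κ = W / (4 * (Fintype.card V : ℝ) ^ 2)) :
    W / 4 ≤ ∑ a, ∑ b, ∑ c, ∑ d,
      codegInv q κ a c * (if b = d then 0 else q a b * q b c * q c d * q d a) := by
  have hN : 0 < (Fintype.card V : ℝ) := by exact_mod_cast Fintype.card_pos
  have hκpos : 0 < κ := by rw [hκ]; positivity
  have hθκ : θ ^ 2 ≤ κ / 2 := by
    rw [hκ, div_div, le_div_iff₀ (by positivity)]; linarith
  have hθ0 : 0 ≤ θ := by
    obtain ⟨v⟩ := ‹Nonempty V›
    exact (h0 v v).trans (hθ v v)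
  -- The square of the codegree counts pairs (b, d); the subtracted term bounds the degenerate pairs
  -- b = d.
  have hcycle : ∀ a c, codeg q a c ^ 2 - θ ^ 2 * codeg q a c ≤
      ∑ b, ∑ d, (if b = d then 0 else q a b * q b c * q c d * q d a) := by
    intro a c
    have e : ∀ b d, (if b = d then 0 else q a b * q b c * q c d * q d a) =
        (q a b * q b c) * (q a d * q d c) - if b = d then (q a b * q b c) ^ 2 else 0 := by
      intro b d
      rw [hs c d, hs d a]
      split_ifs with h
      · subst h; ring
      · ring
    simp_rw [e, Finset.sum_sub_distrib]
    rw [← Finset.sum_mul_sum, ← sq]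
    simp only [Finset.sum_ite_eq, Finset.mem_univ, if_true]
    refine sub_le_sub_left ?_ _
    rw [codeg, Finset.mul_sum]
    refine Finset.sum_le_sum fun b _ => ?_
    rw [sq]
    refine mul_le_mul_of_nonneg_right ?_ (mul_nonneg (h0 _ _) (h0 _ _))
    rw [sq]
    exact mul_le_mul (hθ _ _) (hθ _ _) (h0 _ _) hθ0
  -- Summed over a and c, the diagonal and the threshold κ cost at most W/4 each, so (W - W/2)/2 =
  -- W/4 remains.
  have hterm : ∀ a c, (codeg q a c - (if a = c then codeg q a c else 0) - κ) / 2 ≤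
      codegInv q κ a c * ∑ b, ∑ d, (if b = d then 0 else q a b * q b c * q c d * q d a) := by
    intro a c
    have hcy := hcycle a c
    have hc0 := codeg_nonneg h0 a c
    by_cases hg : a ≠ c ∧ κ ≤ codeg q a c
    · rw [codegInv, if_pos hg, if_neg hg.1]
      have hpos : 0 < codeg q a c := hκpos.trans_le hg.2
      rw [inv_mul_eq_div, le_div_iff₀ hpos]
      refine le_trans ?_ hcy
      nlinarith [hg.2]
    · rw [codegInv, if_neg hg, zero_mul]
      by_cases hac : a = c
      · rw [if_pos hac]; linarith
      · rw [if_neg hac]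
        have : codeg q a c < κ := not_le.1 fun h => hg ⟨hac, h⟩
        linarith
  have hdiag : ∑ a, codeg q a a ≤ θ * ∑ a, ∑ b, q a b := by
    rw [Finset.mul_sum]
    refine Finset.sum_le_sum fun a _ => ?_
    rw [codeg, Finset.mul_sum]
    refine Finset.sum_le_sum fun b _ => ?_
    rw [hs b a]
    exact mul_le_mul_of_nonneg_right (hθ _ _) (h0 _ _)
  have hsum : ∑ a, ∑ b, ∑ c, ∑ d,
      codegInv q κ a c * (if b = d then 0 else q a b * q b c * q c d * q d a) =
      ∑ a, ∑ c, codegInv q κ a c *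
        ∑ b, ∑ d, (if b = d then 0 else q a b * q b c * q c d * q d a) := by
    refine Finset.sum_congr rfl fun a _ => ?_
    rw [Finset.sum_comm]
    simp_rw [Finset.mul_sum]
  rw [hsum]
  refine le_trans ?_ (Finset.sum_le_sum fun a _ => Finset.sum_le_sum fun c _ => hterm a c)
  simp_rw [← Finset.sum_div, Finset.sum_sub_distrib]
  rw [← hW]
  simp only [Finset.sum_ite_eq, Finset.mem_univ, if_true, Finset.sum_const, Finset.card_univ,
    nsmul_eq_mul]
  have : (Fintype.card V : ℝ) * (Fintype.card V * κ) = W / 4 := by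
    rw [hκ]; field_simp
  rw [this]
  linarith

/-- The weighted number of four-cycles sharing an edge with `(a, b, c, d)`, split according to
the shared vertices. -/
lemma sum_shared_le [DecidableEq V] (h0 : ∀ u v, 0 ≤ q u v) (hs : ∀ u v, q u v = q v u)
    (hθ : ∀ u v, q u v ≤ θ) (hκ : 0 < κ) (hD : ∀ b, ∑ a, q b a ≤ D) (a b c d : V) :
    ∑ x, ∑ y, ∑ z, ∑ u, codegInv q κ x z *
      ((if x = a ∧ y = b then q y z * q z u * q u x else 0) +
      (if y = b ∧ z = c then q x y * q z u * q u x else 0) +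
      (if z = c ∧ u = d then q x y * q y z * q u x else 0) +
      (if x = a ∧ u = d then q x y * q y z * q z u else 0) +
      (if x = a ∧ y = b ∧ z = c then q z u * q u x else 0) +
      (if y = b ∧ z = c ∧ u = d then q x y * q u x else 0) +
      (if x = a ∧ z = c ∧ u = d then q x y * q y z else 0) +
      (if x = a ∧ y = b ∧ u = d then q y z * q z u else 0) +
      (if x = a ∧ y = b ∧ z = c ∧ u = d then 1 else 0)) ≤
    4 * D + 2 + 2 * (κ⁻¹ * θ * D) + κ⁻¹ := by
  have hg0 : ∀ x z, 0 ≤ codegInv q κ x z := codegInv_nonneg h0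
  have hgc : ∀ x z, codegInv q κ x z * codeg q z x ≤ 1 := fun x z => by
    rw [codeg_comm hs]; exact codegInv_mul_codeg_le x z
  have hgc' : ∀ x z, codegInv q κ x z * codeg q x z ≤ 1 := codegInv_mul_codeg_le
  have hD' : ∀ b, ∑ a, q a b ≤ D := fun b => by simp_rw [hs _ b]; exact hD b
  have hgθ : ∀ x z s t, codegInv q κ x z * q s t ≤ κ⁻¹ * θ := fun x z s t =>
    mul_le_mul (codegInv_le hκ x z) (hθ s t) (h0 s t) (inv_nonneg.2 hκ.le)
  simp only [mul_add, Finset.sum_add_distrib, mul_ite, mul_zero, ite_and,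
    Finset.sum_ite_irrel, Finset.sum_const_zero, Finset.sum_ite_eq', Finset.mem_univ, if_true]
  -- One shared edge: summing over the vertex opposite to one of its ends in the b, d position gives
  -- a codegree that cancels the weight, leaving a degree.
  have t1 : ∑ z, ∑ u, codegInv q κ a z * (q b z * q z u * q u a) ≤ D := by
    refine le_trans (Finset.sum_le_sum fun z _ => ?_) (hD b)
    have : ∑ u, codegInv q κ a z * (q b z * q z u * q u a) =
        q b z * (codegInv q κ a z * codeg q z a) := by
      simp_rw [codeg, Finset.mul_sum]
      exact Finset.sum_congr rfl fun _ _ => by ring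
    rw [this]
    exact mul_le_of_le_one_right (h0 _ _) (hgc _ _)
  have t2 : ∑ x, ∑ u, codegInv q κ x c * (q x b * q c u * q u x) ≤ D := by
    refine le_trans (Finset.sum_le_sum fun x _ => ?_) (hD' b)
    have : ∑ u, codegInv q κ x c * (q x b * q c u * q u x) =
        q x b * (codegInv q κ x c * codeg q c x) := by
      simp_rw [codeg, Finset.mul_sum]
      exact Finset.sum_congr rfl fun _ _ => by ring
    rw [this]
    exact mul_le_of_le_one_right (h0 _ _) (hgc _ _)
  have t3 : ∑ x, ∑ y, codegInv q κ x c * (q x y * q y c * q d x) ≤ D := by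
    refine le_trans (Finset.sum_le_sum fun x _ => ?_) (hD d)
    have : ∑ y, codegInv q κ x c * (q x y * q y c * q d x) =
        q d x * (codegInv q κ x c * codeg q x c) := by
      simp_rw [codeg, Finset.mul_sum]
      exact Finset.sum_congr rfl fun _ _ => by ring
    rw [this]
    exact mul_le_of_le_one_right (h0 _ _) (hgc' _ _)
  have t4 : ∑ y, ∑ z, codegInv q κ a z * (q a y * q y z * q z d) ≤ D := by
    rw [Finset.sum_comm]
    refine le_trans (Finset.sum_le_sum fun z _ => ?_) (hD' d)
    have : ∑ y, codegInv q κ a z * (q a y * q y z * q z d) =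
        q z d * (codegInv q κ a z * codeg q a z) := by
      simp_rw [codeg, Finset.mul_sum]
      exact Finset.sum_congr rfl fun _ _ => by ring
    rw [this]
    exact mul_le_of_le_one_right (h0 _ _) (hgc' _ _)
  have t5 : ∑ u, codegInv q κ a c * (q c u * q u a) ≤ 1 := by
    rw [← Finset.mul_sum]; exact hgc a c
  -- Here an endpoint of the weighted pair is free, so no codegree appears to cancel the weight; the
  -- crude bound κ⁻¹ is used.
  have t6 : ∑ x, codegInv q κ x c * (q x b * q d x) ≤ κ⁻¹ * θ * D := by
    refine le_trans (Finset.sum_le_sum fun x _ => ?_)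
      ((Finset.mul_sum Finset.univ (fun x => q d x) (κ⁻¹ * θ)).symm.trans_le
        (mul_le_mul_of_nonneg_left (hD d)
          (mul_nonneg (inv_nonneg.2 hκ.le) ((h0 a a).trans (hθ a a)))))
    rw [← mul_assoc]
    exact mul_le_mul_of_nonneg_right (hgθ _ _ _ _) (h0 _ _)
  have t7 : ∑ y, codegInv q κ a c * (q a y * q y c) ≤ 1 := by
    rw [← Finset.mul_sum]; exact hgc' a c
  have t8 : ∑ z, codegInv q κ a z * (q b z * q z d) ≤ κ⁻¹ * θ * D := by
    refine le_trans (Finset.sum_le_sum fun x _ => ?_)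
      ((Finset.mul_sum Finset.univ (fun x => q x d) (κ⁻¹ * θ)).symm.trans_le
        (mul_le_mul_of_nonneg_left (hD' d)
          (mul_nonneg (inv_nonneg.2 hκ.le) ((h0 a a).trans (hθ a a)))))
    rw [← mul_assoc]
    exact mul_le_mul_of_nonneg_right (hgθ _ _ _ _) (h0 _ _)
  have t9 := codegInv_le (q := q) hκ a c
  linarith

end Kernel

/-! ### Random graphs with small edge probabilities -/

section LightEdges

variable {V : Type*} [Fintype V] [DecidableEq V]

/-- Expansion over the patterns of agreement of the vertices of two four-cycles. -/
lemma shared_pattern_le (A B C E : Prop) [Decidable A] [Decidable B] [Decidable C] [Decidable E]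
    {r s t u : ℝ} (hr : 0 ≤ r) (hs : 0 ≤ s) (ht : 0 ≤ t) (hu : 0 ≤ u) :
    (if A ∧ B then 1 else r) * (if B ∧ C then 1 else s) * (if C ∧ E then 1 else t) *
        (if E ∧ A then 1 else u) - r * s * t * u ≤
      (if A ∧ B then s * t * u else 0) + (if B ∧ C then r * t * u else 0) +
      (if C ∧ E then r * s * u else 0) + (if A ∧ E then r * s * t else 0) +
      (if A ∧ B ∧ C then t * u else 0) + (if B ∧ C ∧ E then r * u else 0) +
      (if A ∧ C ∧ E then r * s else 0) + (if A ∧ B ∧ E then s * t else 0) +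
      (if A ∧ B ∧ C ∧ E then 1 else 0) := by
  have m := mul_nonneg (mul_nonneg (mul_nonneg hr hs) ht) hu
  have m1 := mul_nonneg (mul_nonneg hs ht) hu
  have m2 := mul_nonneg (mul_nonneg hr ht) hu
  have m3 := mul_nonneg (mul_nonneg hr hs) hu
  have m4 := mul_nonneg (mul_nonneg hr hs) ht
  have m5 := mul_nonneg ht hu
  have m6 := mul_nonneg hr hu
  have m7 := mul_nonneg hr hs
  have m8 := mul_nonneg hs ht
  by_cases hA : A <;> by_cases hB : B <;> by_cases hC : C <;> by_cases hE : E <;>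
    simp only [hA, hB, hC, hE, and_true, and_false, and_self, if_true, if_false, one_mul,
      mul_one] <;> linarith

/-- The coloured edges of the closed walk `a b c d`. -/
def cycleEdges (t : V × V × V × V) : Fin 4 → V × V :=
  ![(t.1, t.2.1), (t.2.1, t.2.2.1), (t.2.2.1, t.2.2.2), (t.2.2.2, t.1)]

/-- If the edges of small probability have large expected number, then four random graphs
contain a coloured four-cycle with probability close to one. -/
lemma coloured_light [Nonempty V] {p : V × V → ℝ} (h0 : ∀ e, 0 ≤ p e) (h1 : ∀ e, p e ≤ 1)
    (hs : ∀ u v, p (u, v) = p (v, u)) (R : V → V → Prop) [∀ u v, Decidable (R u v)]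
    (hR : ∀ u v, R u v → R v u) {θ : ℝ} (hθ0 : 0 ≤ θ)
    (hθ1 : θ ≤ 1) (hθ : ∀ u v, R u v → p (u, v) ≤ θ) {T : ℝ}
    (hT : T = ∑ u, ∑ v, if R u v then p (u, v) else 0)
    (hT1 : 300 * (Fintype.card V : ℝ) ≤ T) (hT2 : 8 * (Fintype.card V : ℝ) ^ 3 * θ ^ 2 ≤ T ^ 2)
    (F : Finset (Σ _ : Fin 4, V × V) → Prop) [DecidablePred F]
    (hF : ∀ S, F S → ∀ a b c d, R a b → R b c → R c d → R d a → a ≠ c → b ≠ d →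
      ∃ i, ⟨i, cycleEdges (a, b, c, d) i⟩ ∉ S) :
    subsetExp (fun t : Σ _ : Fin 4, V × V => p t.2) (fun S => if F S then 1 else 0) ≤ 1 / 6 := by
  set N : ℝ := (Fintype.card V : ℝ) with hNdef
  have hN : 1 ≤ N := by
    rw [hNdef]; exact_mod_cast Fintype.card_pos (α := V)
  set q : V → V → ℝ := fun u v => if R u v then p (u, v) else 0 with hq
  have q0 : ∀ u v, 0 ≤ q u v := fun u v => by
    simp only [hq]; split_ifs
    · exact h0 _
    · exact le_rfl
  have qs : ∀ u v, q u v = q v u := fun u v => by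
    simp only [hq, hs u v, show R u v ↔ R v u from ⟨hR u v, hR v u⟩]
  have qθ : ∀ u v, q u v ≤ θ := fun u v => by
    simp only [hq]; split_ifs with h
    · exact hθ u v h
    · exact hθ0
  set W : ℝ := ∑ a, ∑ c, codeg q a c with hW
  have hWdeg : W = ∑ b, (∑ a, q b a) ^ 2 := sum_codeg qs
  -- Cauchy–Schwarz over degrees: W is the sum of the squared degrees and T their sum.
  have hTW : T ^ 2 ≤ N * W := by
    rw [hWdeg, hT]
    have := sq_sum_le_card_mul_sum_sq (s := (Finset.univ : Finset V)) (f := fun b => ∑ a, q b a)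
    simpa [hNdef] using this
  have hW1 : 90000 * N ≤ W := by nlinarith
  have hWpos : 0 < W := by linarith
  have hW8 : 8 * N ^ 2 * θ ^ 2 ≤ W := by
    have : N * (8 * N ^ 2 * θ ^ 2) ≤ N * W := by linarith
    exact le_of_mul_le_mul_left this (by linarith)
  have hW4 : 4 * (θ * ∑ a, ∑ b, q a b) ≤ W := by
    have h4 : ∑ a, ∑ b, q a b = T := hT.symm
    rw [h4]
    have hT0 : 0 ≤ T := by linarith
    have hθT : θ * T ≤ T := mul_le_of_le_one_left hT0 hθ1
    have : N * (4 * (θ * T)) ≤ N * W := by nlinarith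
    exact le_of_mul_le_mul_left this (by linarith)
  set κ : ℝ := W / (4 * N ^ 2) with hκ
  have hκpos : 0 < κ := by positivity
  have hM := le_sum_codegInv_mul q0 qs qθ hW hWpos hW8 hW4 hκ
  set D : ℝ := √W with hDdef
  have hDD : D * D = W := Real.mul_self_sqrt hWpos.le
  have hD0 : 0 ≤ D := Real.sqrt_nonneg _
  have hD : ∀ b, ∑ a, q b a ≤ D := fun b => by
    refine Real.le_sqrt_of_sq_le ?_
    rw [hWdeg]
    exact Finset.single_le_sum (f := fun b => (∑ a, q b a) ^ 2) (fun b _ => sq_nonneg _)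
      (Finset.mem_univ b)
  set K : ℝ := 4 * D + 2 + 2 * (κ⁻¹ * θ * D) + κ⁻¹ with hK
  -- The target is K ≤ M/6 with M ≥ W/4. The main term 4D is small since D² = W and D ≥ 300; the
  -- others are O(N), while W ≥ 90000 N.
  have hKW : K ≤ W / 24 := by
    have hD300 : 300 ≤ D := Real.le_sqrt_of_sq_le (by nlinarith)
    have hNθ : N * θ ≤ D := Real.le_sqrt_of_sq_le (by nlinarith [sq_nonneg (N * θ)])
    have hκinv : κ⁻¹ = 4 * N * N / W := by rw [hκ, inv_div]; ring
    have k1 : κ⁻¹ ≤ 4 * N := by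
      rw [hκinv, div_le_iff₀ hWpos]
      nlinarith
    have k2 : κ⁻¹ * θ * D ≤ 4 * N := by
      rw [hκinv, div_mul_eq_mul_div, div_mul_eq_mul_div, div_le_iff₀ hWpos, ← hDD]
      have := mul_le_mul_of_nonneg_right hNθ hD0
      nlinarith
    nlinarith
  -- The condition b ≠ d, with a ≠ c built into `codegInv`, leaves weight only on nondegenerate
  -- cycles.
  set w : V × V × V × V → ℝ := fun t =>
    if t.2.1 ≠ t.2.2.2 ∧ R t.1 t.2.1 ∧ R t.2.1 t.2.2.1 ∧ R t.2.2.1 t.2.2.2 ∧ R t.2.2.2 t.1 then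
      codegInv q κ t.1 t.2.2.1 else 0 with hw
  have hg0 := codegInv_nonneg (κ := κ) q0
  have w0 : ∀ t, 0 ≤ w t := fun t => by
    simp only [hw]; split_ifs
    · exact hg0 _ _
    · exact le_rfl
  have key := coloured_second_moment h0 h1 cycleEdges w F (fun S hS t hwt => by
    obtain ⟨a, b, c, d⟩ := t
    simp only [hw, codegInv, ne_eq, ite_eq_right_iff, not_forall] at hwt
    obtain ⟨h, h', -⟩ := hwt
    exact hF S hS a b c d h.2.1 h.2.2.1 h.2.2.2.1 h.2.2.2.2 h'.1 h.1)
  set M : ℝ := ∑ t, w t * ∏ i, p (cycleEdges t i) with hMdef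
  have hMW : W / 4 ≤ M := by
    refine hM.trans_eq ?_
    rw [hMdef, Fintype.sum_prod_type]
    simp_rw [Fintype.sum_prod_type]
    refine Finset.sum_congr rfl fun a _ => Finset.sum_congr rfl fun b _ =>
      Finset.sum_congr rfl fun c _ => Finset.sum_congr rfl fun d _ => ?_
    simp only [hw, cycleEdges, Fin.prod_univ_four, Matrix.cons_val, hq]
    by_cases hbd : b = d
    · simp [hbd]
    · by_cases r1 : R a b <;> by_cases r2 : R b c <;> by_cases r3 : R c d <;>
        by_cases r4 : R d a <;> simp [hbd, r1, r2, r3, r4]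
  have hpair : ∀ s t : V × V × V × V, w t *
      (∏ i, (if cycleEdges s i = cycleEdges t i then 1 else p (cycleEdges t i)) -
        ∏ i, p (cycleEdges t i)) ≤ codegInv q κ t.1 t.2.2.1 *
      ((if t.1 = s.1 ∧ t.2.1 = s.2.1 then
          q t.2.1 t.2.2.1 * q t.2.2.1 t.2.2.2 * q t.2.2.2 t.1 else 0) +
      (if t.2.1 = s.2.1 ∧ t.2.2.1 = s.2.2.1 then
          q t.1 t.2.1 * q t.2.2.1 t.2.2.2 * q t.2.2.2 t.1 else 0) +
      (if t.2.2.1 = s.2.2.1 ∧ t.2.2.2 = s.2.2.2 then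
          q t.1 t.2.1 * q t.2.1 t.2.2.1 * q t.2.2.2 t.1 else 0) +
      (if t.1 = s.1 ∧ t.2.2.2 = s.2.2.2 then
          q t.1 t.2.1 * q t.2.1 t.2.2.1 * q t.2.2.1 t.2.2.2 else 0) +
      (if t.1 = s.1 ∧ t.2.1 = s.2.1 ∧ t.2.2.1 = s.2.2.1 then
          q t.2.2.1 t.2.2.2 * q t.2.2.2 t.1 else 0) +
      (if t.2.1 = s.2.1 ∧ t.2.2.1 = s.2.2.1 ∧ t.2.2.2 = s.2.2.2 then
          q t.1 t.2.1 * q t.2.2.2 t.1 else 0) +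
      (if t.1 = s.1 ∧ t.2.2.1 = s.2.2.1 ∧ t.2.2.2 = s.2.2.2 then
          q t.1 t.2.1 * q t.2.1 t.2.2.1 else 0) +
      (if t.1 = s.1 ∧ t.2.1 = s.2.1 ∧ t.2.2.2 = s.2.2.2 then
          q t.2.1 t.2.2.1 * q t.2.2.1 t.2.2.2 else 0) +
      (if t.1 = s.1 ∧ t.2.1 = s.2.1 ∧ t.2.2.1 = s.2.2.1 ∧ t.2.2.2 = s.2.2.2 then 1 else 0)) := by
    rintro ⟨a, b, c, d⟩ ⟨x, y, z, u⟩
    have n1 := q0 x y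
    have n2 := q0 y z
    have n3 := q0 z u
    have n4 := q0 u x
    by_cases hlight : y ≠ u ∧ R x y ∧ R y z ∧ R z u ∧ R u x
    · have hwt : w (x, y, z, u) = codegInv q κ x z := if_pos hlight
      have e1 : p (x, y) = q x y := (if_pos hlight.2.1).symm
      have e2 : p (y, z) = q y z := (if_pos hlight.2.2.1).symm
      have e3 : p (z, u) = q z u := (if_pos hlight.2.2.2.1).symm
      have e4 : p (u, x) = q u x := (if_pos hlight.2.2.2.2).symm
      rw [hwt]
      refine mul_le_mul_of_nonneg_left ?_ (hg0 x z)
      simp only [cycleEdges, Fin.prod_univ_four, Matrix.cons_val, Prod.mk.injEq, e1, e2, e3, e4]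
      simp only [eq_comm (a := x), eq_comm (a := y), eq_comm (a := z), eq_comm (a := u)]
      exact shared_pattern_le _ _ _ _ n1 n2 n3 n4
    · have hwt : w (x, y, z, u) = 0 := if_neg hlight
      rw [hwt, zero_mul]
      refine mul_nonneg (hg0 x z) ?_
      positivity
  have hVar : subsetExp (fun t : Σ _ : Fin 4, V × V => p t.2) (fun S => if F S then 1 else 0) *
      M ^ 2 ≤ M * K := by
    refine key.trans ?_
    rw [hMdef, Finset.sum_mul]
    refine Finset.sum_le_sum fun s _ => ?_
    have hfac : ∑ t, w s * w t * ((∏ i, p (cycleEdges s i)) *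
        (∏ i, (if cycleEdges s i = cycleEdges t i then 1 else p (cycleEdges t i)) -
          ∏ i, p (cycleEdges t i))) = w s * (∏ i, p (cycleEdges s i)) * ∑ t, w t *
        (∏ i, (if cycleEdges s i = cycleEdges t i then 1 else p (cycleEdges t i)) -
          ∏ i, p (cycleEdges t i)) := by
      rw [Finset.mul_sum]
      exact Finset.sum_congr rfl fun t _ => by ring
    rw [hfac]
    refine mul_le_mul_of_nonneg_left ?_
      (mul_nonneg (w0 s) (Finset.prod_nonneg fun i _ => h0 _))
    refine (Finset.sum_le_sum fun t _ => hpair s t).trans ?_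
    have := sum_shared_le q0 qs qθ hκpos hD s.1 s.2.1 s.2.2.1 s.2.2.2
    simp only [Fintype.sum_prod_type]
    exact this
  have hMpos : 0 < M := by linarith
  have hEM : subsetExp (fun t : Σ _ : Fin 4, V × V => p t.2) (fun S => if F S then 1 else 0) *
      M ≤ K := by
    refine le_of_mul_le_mul_right ?_ hMpos
    linarith
  have : subsetExp (fun t : Σ _ : Fin 4, V × V => p t.2) (fun S => if F S then 1 else 0) * M ≤
      1 / 6 * M := by linarith
  exact le_of_mul_le_mul_right this hMpos

end LightEdges

/-! ### Poissonization -/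

section Poisson

lemma hasSum_poisson_weights (r : ℝ) :
    HasSum (fun k : ℕ => Real.exp (-r) * (r ^ k / k.factorial)) 1 := by
  have h := (NormedSpace.expSeries_div_hasSum_exp r).mul_left (Real.exp (-r))
  rwa [← Real.exp_eq_exp_ℝ, ← Real.exp_add, neg_add_cancel, Real.exp_zero] at h

lemma hasSum_poisson_mean (r : ℝ) :
    HasSum (fun k : ℕ => Real.exp (-r) * (r ^ k / k.factorial) * k) r := by
  rw [← hasSum_nat_add_iff' 1]
  have h := (hasSum_poisson_weights r).mul_left r
  simp only [Finset.range_one, Finset.sum_singleton, Nat.cast_zero, mul_zero, sub_zero]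
  rw [mul_one] at h
  refine h.congr_fun ?_
  intro k
  rw [Nat.factorial_succ]
  have := Nat.factorial_ne_zero k
  push_cast
  field_simp
  ring

lemma sum_fiber {E X : Type*} [DecidableEq E] [Fintype X] (f : X → Finset E) (a : X → ℝ) (s : Finset (Finset E)) :
    ∑ T ∈ s, ∑ x, (if f x = T then a x else 0) = ∑ x, if f x ∈ s then a x else 0 := by
  rw [Finset.sum_comm]
  simp

variable {E : Type*} [Fintype E] [DecidableEq E]

/-- The probability that the set of values of `k` independent samples satisfies `F`. -/
noncomputable def sampleProb (wt : E → ℝ) (F : Finset E → Prop) [DecidablePred F] (k : ℕ) : ℝ :=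
  ∑ x : Fin k → E, if F (Finset.univ.image x) then ∏ i, wt (x i) else 0

lemma sampleProb_nonneg {wt : E → ℝ} (hwt : ∀ e, 0 ≤ wt e) (F : Finset E → Prop)
    [DecidablePred F] (k : ℕ) : 0 ≤ sampleProb wt F k :=
  Finset.sum_nonneg fun x _ => by
    split_ifs
    · exact Finset.prod_nonneg fun i _ => hwt _
    · exact le_rfl

lemma sampleProb_subset (wt : E → ℝ) (A : Finset E) (k : ℕ) :
    sampleProb wt (· ⊆ A) k = (∑ e ∈ A, wt e) ^ k := by
  have : ∑ e ∈ A, wt e = ∑ e, if e ∈ A then wt e else 0 := by simp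
  rw [this, Fintype.sum_pow, sampleProb]
  refine Finset.sum_congr rfl fun x _ => ?_
  split_ifs with h
  · exact Finset.prod_congr rfl fun i _ => by
      rw [if_pos (h (Finset.mem_image_of_mem x (Finset.mem_univ i)))]
  · obtain ⟨e, he, heA⟩ := Finset.not_subset.1 h
    obtain ⟨i, -, rfl⟩ := Finset.mem_image.1 he
    exact (Finset.prod_eq_zero (Finset.mem_univ i) (if_neg heA)).symm

/-- Dropping the first sample only shrinks the sampled set, which preserves a decreasing event. -/
lemma sampleProb_antitone {wt : E → ℝ} (hwt : ∀ e, 0 ≤ wt e) (h1 : ∑ e, wt e = 1)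
    (F : Finset E → Prop) [DecidablePred F] (hF : ∀ S T, S ⊆ T → F T → F S) :
    Antitone (sampleProb wt F) := by
  refine antitone_nat_of_succ_le fun k => ?_
  have e : sampleProb wt F (k + 1) = ∑ e : E, ∑ x : Fin k → E,
      if F (Finset.univ.image (Fin.cons e x : Fin (k + 1) → E)) then
        wt e * ∏ i, wt (x i) else 0 := by
    rw [sampleProb, ← Fintype.sum_prod_type', ← (Fin.consEquiv fun _ => E).sum_comp]
    refine Finset.sum_congr rfl fun x _ => ?_
    simp [Fin.consEquiv, Fin.prod_univ_succ]
  have e' : sampleProb wt F k = ∑ e : E, wt e * sampleProb wt F k := by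
    rw [← Finset.sum_mul, h1, one_mul]
  rw [e, e']
  refine Finset.sum_le_sum fun e _ => ?_
  rw [sampleProb, Finset.mul_sum]
  refine Finset.sum_le_sum fun x _ => ?_
  have hp : 0 ≤ wt e * ∏ i, wt (x i) :=
    mul_nonneg (hwt e) (Finset.prod_nonneg fun i _ => hwt _)
  split_ifs with h h'
  · exact le_rfl
  · refine absurd (hF _ _ ?_ h) h'
    intro a ha
    obtain ⟨i, -, rfl⟩ := Finset.mem_image.1 ha
    exact Finset.mem_image.2 ⟨i.succ, Finset.mem_univ _, by simp⟩
  · exact hp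
  · simp

/-- A distribution `ρ` on finite sets with the same containment probabilities as a Poisson number
of independent samples is the distribution of the set of these samples. -/
lemma hasSum_poisson_sampleProb_eq {wt : E → ℝ} (h1 : ∑ e, wt e = 1) (r : ℝ) (ρ : Finset E → ℝ)
    (hρ : ∀ A : Finset E, ∑ T ∈ A.powerset, ρ T = Real.exp (-(r * ∑ e ∈ Aᶜ, wt e)))
    (A : Finset E) :
    HasSum (fun k : ℕ => Real.exp (-r) * (r ^ k / k.factorial) * sampleProb wt (· = A) k)
      (ρ A) := by
  induction A using Finset.strongInduction with
  | H A ih =>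
  -- Both laws agree on the events "contained in A"; subtracting the proper subsets, known by
  -- induction, gives agreement at A.
  have hsub : HasSum (fun k : ℕ => Real.exp (-r) * (r ^ k / k.factorial) *
      sampleProb wt (· ⊆ A) k) (∑ T ∈ A.powerset, ρ T) := by
    have h := (NormedSpace.expSeries_div_hasSum_exp (r * ∑ e ∈ A, wt e)).mul_left (Real.exp (-r))
    have e2 : Real.exp (-r) * NormedSpace.exp (r * ∑ e ∈ A, wt e) = ∑ T ∈ A.powerset, ρ T := by
      rw [← Real.exp_eq_exp_ℝ, ← Real.exp_add, hρ]
      congr 1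
      have := Finset.sum_add_sum_compl A wt
      rw [h1] at this
      linear_combination r * this
    rw [e2] at h
    refine h.congr_fun fun k => ?_
    rw [sampleProb_subset, mul_pow]
    ring
  have hss := hasSum_sum (s := A.ssubsets) fun T hT => ih T (Finset.mem_ssubsets.1 hT)
  have h := hsub.sub hss
  have eρ : ∑ T ∈ A.powerset, ρ T - ∑ T ∈ A.ssubsets, ρ T = ρ A := by
    rw [Finset.ssubsets, Finset.sum_erase_eq_sub (Finset.mem_powerset_self A)]
    ring
  rw [eρ] at h
  refine h.congr_fun fun k => ?_
  rw [← Finset.mul_sum, ← mul_sub]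
  congr 1
  have hp : sampleProb wt (· ⊆ A) k = ∑ T ∈ A.powerset, sampleProb wt (· = T) k := by
    simp only [sampleProb]
    rw [sum_fiber]
    simp
  rw [hp, Finset.ssubsets, Finset.sum_erase_eq_sub (Finset.mem_powerset_self A)]
  ring

/-- Poissonization: if `ρ` has the containment probabilities of a Poisson number, with mean `m / 2`,
of samples, then a decreasing event has at most twice the `ρ`-probability for `m` samples. -/
lemma sampleProb_le_two_mul {wt : E → ℝ} (hwt : ∀ e, 0 ≤ wt e) (h1 : ∑ e, wt e = 1)
    {m : ℕ} (hm : 0 < m) (ρ : Finset E → ℝ)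
    (hρ : ∀ A : Finset E, ∑ T ∈ A.powerset, ρ T = Real.exp (-((m / 2 : ℝ) * ∑ e ∈ Aᶜ, wt e)))
    (F : Finset E → Prop) [DecidablePred F] (hF : ∀ S T, S ⊆ T → F T → F S) :
    sampleProb wt F m ≤ 2 * ∑ T, if F T then ρ T else 0 := by
  set r : ℝ := m / 2 with hr
  have hm' : (0 : ℝ) < m := by exact_mod_cast hm
  have hs : HasSum (fun k : ℕ => Real.exp (-r) * (r ^ k / k.factorial) * sampleProb wt F k)
      (∑ T, if F T then ρ T else 0) := by
    rw [← Finset.sum_filter]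
    have h := hasSum_sum (s := Finset.univ.filter F)
      fun T _ => hasSum_poisson_sampleProb_eq h1 r ρ hρ T
    refine h.congr_fun fun k => ?_
    rw [← Finset.mul_sum]
    congr 1
    simp only [sampleProb]
    rw [sum_fiber]
    simp
  have hl := ((hasSum_poisson_weights r).sub
    ((hasSum_poisson_mean r).div_const (m : ℝ))).mul_right (sampleProb wt F m)
  -- Pointwise (1 - k/m) f(m) ≤ f(k): by monotonicity for k ≤ m, by sign for k ≥ m. Averaging over k
  -- of mean m/2 gives the factor 1/2.
  have hle := hasSum_le (fun k => ?_) hl hs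
  · have : (1 - r / m) * sampleProb wt F m = sampleProb wt F m / 2 := by
      rw [hr]; field_simp; ring
    linarith
  · have hc : 0 ≤ Real.exp (-r) * (r ^ k / k.factorial) := by positivity
    have e : (Real.exp (-r) * (r ^ k / k.factorial) -
        Real.exp (-r) * (r ^ k / k.factorial) * k / m) * sampleProb wt F m =
        Real.exp (-r) * (r ^ k / k.factorial) * ((1 - k / m) * sampleProb wt F m) := by ring
    rw [e]
    refine mul_le_mul_of_nonneg_left ?_ hc
    have hfm := sampleProb_nonneg hwt F m
    have hk0 : (0 : ℝ) ≤ k / m := by positivity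
    rcases le_total k m with hk | hk
    · have := sampleProb_antitone hwt h1 F hF hk
      nlinarith
    · have : (1 : ℝ) ≤ k / m := by
        rw [le_div_iff₀ hm', one_mul]; exact_mod_cast hk
      have := sampleProb_nonneg hwt F k
      nlinarith

end Poisson

/-! ### Fractional square packings and coloured copies of edges -/

section Packing

variable {n : ℕ}

/-- The four vertices of `t` are distinct. -/
def DistinctVertices (t : Fin n × Fin n × Fin n × Fin n) : Prop :=
  t.1 ≠ t.2.1 ∧ t.1 ≠ t.2.2.1 ∧ t.1 ≠ t.2.2.2 ∧ t.2.1 ≠ t.2.2.1 ∧ t.2.1 ≠ t.2.2.2 ∧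
    t.2.2.1 ≠ t.2.2.2

/-- The set of edges of the closed walk `t`. -/
def cycleSet (t : Fin n × Fin n × Fin n × Fin n) : Finset (Edge n) :=
  Finset.univ.filter fun e => ∃ i, e.val = s((cycleEdges t i).1, (cycleEdges t i).2)

lemma mem_cycleSet {t : Fin n × Fin n × Fin n × Fin n} {e : Edge n} :
    e ∈ cycleSet t ↔ ∃ i, e.val = s((cycleEdges t i).1, (cycleEdges t i).2) := by
  simp [cycleSet]

lemma card_cycleSet_le (t : Fin n × Fin n × Fin n × Fin n) : (cycleSet t).card ≤ 4 := by
  have h : (cycleSet t).image (fun e : Edge n => e.val) ⊆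
      Finset.univ.image fun i => s((cycleEdges t i).1, (cycleEdges t i).2) := by
    intro z hz
    obtain ⟨e, he, rfl⟩ := Finset.mem_image.1 hz
    obtain ⟨i, hi⟩ := mem_cycleSet.1 he
    exact Finset.mem_image.2 ⟨i, Finset.mem_univ _, hi.symm⟩
  have h2 := (Finset.card_le_card h).trans Finset.card_image_le
  have hinj : Function.Injective fun e : Edge n => e.val := fun e e' h => Subtype.ext h
  rwa [Finset.card_image_of_injective _ hinj] at h2

lemma coe_cycleSet_mem_squares {t : Fin n × Fin n × Fin n × Fin n} (ht : DistinctVertices t) :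
    (cycleSet t : Set (Edge n)) ∈ squares n := by
  obtain ⟨h1, h2, h3, h4, h5, h6⟩ := ht
  refine ⟨t.1, t.2.1, t.2.2.1, t.2.2.2, h1, h2, h3, h4, h5, h6, ?_⟩
  ext e
  simp [mem_cycleSet, cycleEdges, Fin.exists_fin_succ, Edge.Joins]

lemma exists_cycleSet_eq {Q : Set (Edge n)} (hQ : Q ∈ squares n) :
    ∃ t : Fin n × Fin n × Fin n × Fin n, DistinctVertices t ∧ (cycleSet t : Set (Edge n)) = Q := by
  obtain ⟨a, b, c, d, h1, h2, h3, h4, h5, h6, rfl⟩ := hQ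
  refine ⟨(a, b, c, d), ⟨h1, h2, h3, h4, h5, h6⟩, ?_⟩
  ext e
  simp [mem_cycleSet, cycleEdges, Fin.exists_fin_succ, Edge.Joins]

lemma cycleEdges_ne {t : Fin n × Fin n × Fin n × Fin n} (ht : DistinctVertices t) (i : Fin 4) :
    (cycleEdges t i).1 ≠ (cycleEdges t i).2 := by
  obtain ⟨h1, h2, h3, h4, h5, h6⟩ := ht
  fin_cases i
  · exact h1
  · exact h4
  · exact h6
  · exact h3.symm

lemma cycleSet_nonempty {t : Fin n × Fin n × Fin n × Fin n} (ht : DistinctVertices t) :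
    (cycleSet t).Nonempty :=
  ⟨⟨s(t.1, t.2.1), by simpa using ht.1⟩, mem_cycleSet.2 ⟨0, rfl⟩⟩

/-- A fractional packing of squares into an edge weight, covering all of the weight outside a
square-free set up to a factor `4`. -/
lemma exists_packing (y : Edge n → ℝ) (hy : ∀ e, 0 ≤ y e) :
    ∃ Λ : Fin n × Fin n × Fin n × Fin n → ℝ, (∀ t, 0 ≤ Λ t) ∧
      (∀ t, Λ t ≠ 0 → DistinctVertices t) ∧
      (∀ e, ∑ t, (if e ∈ cycleSet t then Λ t else 0) ≤ y e) ∧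
      ∃ s : Finset (Edge n), SquareFree (s : Set (Edge n)) ∧ ∑ e ∈ sᶜ, y e ≤ 4 * ∑ t, Λ t := by
  induction hk : (Finset.univ.filter fun e => y e ≠ 0).card using Nat.strong_induction_on
    generalizing y with
  | _ k ih =>
  by_cases hsf : SquareFree ((Finset.univ.filter fun e => y e ≠ 0 : Finset (Edge n)) : Set (Edge n))
  · refine ⟨0, by simp, by simp, by simpa using hy, _, hsf, ?_⟩
    refine le_of_eq ?_
    simp only [Pi.zero_apply, Finset.sum_const_zero, mul_zero]
    exact Finset.sum_eq_zero fun e he => by simpa using he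
  · simp only [SquareFree, not_forall, not_not] at hsf
    obtain ⟨Q, hQ, hQs⟩ := hsf
    obtain ⟨t₀, ht₀, rfl⟩ := exists_cycleSet_eq hQ
    -- Greedy step: give the square its least edge weight and subtract this from its edges. Weights
    -- stay nonnegative and e₀ leaves the support.
    obtain ⟨e₀, he₀, hmin⟩ := (cycleSet t₀).exists_min_image y (cycleSet_nonempty ht₀)
    have hne : y e₀ ≠ 0 := by simpa using hQs he₀
    set y' : Edge n → ℝ := fun e => y e - if e ∈ cycleSet t₀ then y e₀ else 0 with hy'
    have hy0 : ∀ e, 0 ≤ y' e := fun e => by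
      simp only [hy']
      split_ifs with h
      · exact sub_nonneg.2 (hmin e h)
      · simpa using hy e
    have hlt : (Finset.univ.filter fun e => y' e ≠ 0).card < k := by
      rw [← hk]
      refine Finset.card_lt_card (Finset.ssubset_iff_of_subset ?_ |>.2 ⟨e₀, by simpa using hne, ?_⟩)
      · intro e he
        simp only [Finset.mem_filter, Finset.mem_univ, true_and] at he ⊢
        intro h0
        have h1 := hy0 e
        have h2 := hy e₀
        apply he
        simp only [hy', h0] at h1 ⊢
        split_ifs at h1 ⊢ <;> linarith
      · simp [hy', he₀]
    obtain ⟨Λ, hΛ0, hΛd, hΛl, s, hs, hsum⟩ := ih _ hlt y' hy0 rfl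
    refine ⟨fun t => Λ t + if t = t₀ then y e₀ else 0, fun t => ?_, fun t ht => ?_, fun e => ?_,
      s, hs, ?_⟩
    · have := hΛ0 t
      have := hy e₀
      dsimp only
      split_ifs <;> linarith
    · by_cases h : t = t₀
      · rwa [h]
      · exact hΛd t (by simpa [h] using ht)
    · have h1 : ∑ t, (if e ∈ cycleSet t then Λ t + (if t = t₀ then y e₀ else 0) else 0) =
          ∑ t, (if e ∈ cycleSet t then Λ t else 0) +
            ∑ t, if t = t₀ then (if e ∈ cycleSet t then y e₀ else 0) else 0 := by
        rw [← Finset.sum_add_distrib]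
        refine Finset.sum_congr rfl fun t _ => ?_
        split_ifs <;> simp
      rw [h1, Finset.sum_ite_eq' Finset.univ t₀]
      have := hΛl e
      simp only [hy'] at this
      simp only [Finset.mem_univ, if_true]
      linarith
    · have h1 : ∑ e ∈ sᶜ, y e = ∑ e ∈ sᶜ, y' e + ∑ e ∈ sᶜ, if e ∈ cycleSet t₀ then y e₀ else 0 := by
        rw [← Finset.sum_add_distrib]
        exact Finset.sum_congr rfl fun e _ => by simp [hy']
      have h2 : ∑ e ∈ sᶜ, (if e ∈ cycleSet t₀ then y e₀ else 0) ≤ 4 * y e₀ := by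
        calc _ ≤ ∑ e, (if e ∈ cycleSet t₀ then y e₀ else 0) :=
              Finset.sum_le_univ_sum_of_nonneg fun e => by
                split_ifs
                · exact hy e₀
                · exact le_rfl
          _ = (cycleSet t₀).card * y e₀ := by simp
          _ ≤ 4 * y e₀ := mul_le_mul_of_nonneg_right
              (by exact_mod_cast card_cycleSet_le t₀) (hy e₀)
      rw [Finset.sum_add_distrib, Finset.sum_ite_eq' Finset.univ t₀]
      simp only [Finset.mem_univ, if_true]
      linarith

/-- The weight of the edge joining the two vertices of a pair, and `0` for a diagonal pair. -/
noncomputable def pairWeight (y : Edge n → ℝ) (t : Fin n × Fin n) : ℝ :=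
  ∑ e : Edge n, if e.val = s(t.1, t.2) then y e else 0

lemma pairWeight_nonneg {y : Edge n → ℝ} (hy : ∀ e, 0 ≤ y e) (t : Fin n × Fin n) :
    0 ≤ pairWeight y t :=
  Finset.sum_nonneg fun e _ => by
    split_ifs
    · exact hy e
    · exact le_rfl

lemma pairWeight_comm (y : Edge n → ℝ) (u v : Fin n) :
    pairWeight y (u, v) = pairWeight y (v, u) := by
  simp only [pairWeight, Sym2.eq_swap]

lemma pairWeight_eq (y : Edge n → ℝ) {e : Edge n} {t : Fin n × Fin n} (h : e.val = s(t.1, t.2)) :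
    pairWeight y t = y e := by
  rw [pairWeight, Finset.sum_eq_single e, if_pos h]
  · intro e' _ hne
    rw [if_neg]
    intro h'
    exact hne (Subtype.ext (h'.trans h.symm))
  · simp

lemma card_pairs_eq_two (e : Edge n) :
    (Finset.univ.filter fun t : Fin n × Fin n => e.val = s(t.1, t.2)).card = 2 := by
  obtain ⟨z, hz⟩ := e
  induction z using Sym2.ind with
  | _ a b =>
  have hab : a ≠ b := by simpa using hz
  have : (Finset.univ.filter fun t : Fin n × Fin n => s(a, b) = s(t.1, t.2)) =
      {(a, b), (b, a)} := by
    ext ⟨u, v⟩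
    simp only [Finset.mem_filter, Finset.mem_univ, true_and, Sym2.eq_iff, Finset.mem_insert,
      Finset.mem_singleton, Prod.mk.injEq]
    constructor <;> rintro (⟨h1, h2⟩ | ⟨h1, h2⟩) <;> simp [h1, h2]
  change (Finset.univ.filter fun t : Fin n × Fin n => s(a, b) = s(t.1, t.2)).card = 2
  rw [this, Finset.card_pair]
  simp [hab]

/-- A tuple with f in place i uses the edge of f, so the packing bound applies; diagonal pairs carry
no load because Λ lives on distinct vertices. -/
lemma sum_load_le {y : Edge n → ℝ} (hy : ∀ e, 0 ≤ y e)
    {Λ : Fin n × Fin n × Fin n × Fin n → ℝ} (hΛ0 : ∀ t, 0 ≤ Λ t)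
    (hΛd : ∀ t, Λ t ≠ 0 → DistinctVertices t)
    (hΛl : ∀ e, ∑ t, (if e ∈ cycleSet t then Λ t else 0) ≤ y e) (i : Fin 4) (f : Fin n × Fin n) :
    ∑ t, (if cycleEdges t i = f then Λ t else 0) ≤ pairWeight y f := by
  by_cases hf : f.1 = f.2
  · refine le_trans (le_of_eq (Finset.sum_eq_zero fun t _ => ?_)) (pairWeight_nonneg hy f)
    split_ifs with h
    · by_contra hne
      exact cycleEdges_ne (hΛd t hne) i (by rw [h, hf])
    · rfl
  · have hd : ¬ (s(f.1, f.2)).IsDiag := by simpa using hf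
    rw [pairWeight_eq y (e := ⟨s(f.1, f.2), hd⟩) rfl]
    refine le_trans (Finset.sum_le_sum fun t _ => ?_) (hΛl _)
    split_ifs with h h' h'
    · exact le_rfl
    · exact absurd (mem_cycleSet.2 ⟨i, by rw [h]⟩) h'
    · exact hΛ0 t
    · exact le_rfl

/-- The edges that occur among the chosen coloured pairs. -/
def edgeImage (S : Finset (Σ _ : Fin 4, Fin n × Fin n)) : Finset (Edge n) :=
  Finset.univ.filter fun e => ∃ t ∈ S, e.val = s(t.2.1, t.2.2)

/-- An edge is absent when all its 4 · 2 = 8 coloured oriented copies are, each independently with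
probability exp (-y e). -/
lemma subsetExp_edgeImage_subset (y : Edge n → ℝ) (A : Finset (Edge n)) :
    subsetExp (fun t : Σ _ : Fin 4, Fin n × Fin n => 1 - Real.exp (-pairWeight y t.2))
      (fun S => if edgeImage S ⊆ A then 1 else 0) = Real.exp (-(8 * ∑ e ∈ Aᶜ, y e)) := by
  set J : Finset (Σ _ : Fin 4, Fin n × Fin n) :=
    Finset.univ.filter fun t => ∃ e ∈ Aᶜ, e.val = s(t.2.1, t.2.2) with hJ
  have hiff : ∀ S, edgeImage S ⊆ A ↔ Disjoint S J := fun S => by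
    rw [Finset.disjoint_left]
    constructor
    · intro h t ht htJ
      simp only [hJ, Finset.mem_filter, Finset.mem_univ, true_and, Finset.mem_compl] at htJ
      obtain ⟨e, heA, he⟩ := htJ
      exact heA (h (by simp only [edgeImage, Finset.mem_filter, Finset.mem_univ, true_and]
                       exact ⟨t, ht, he⟩))
    · intro h e he
      simp only [edgeImage, Finset.mem_filter, Finset.mem_univ, true_and] at he
      obtain ⟨t, ht, he⟩ := he
      by_contra heA
      exact h ht (by simp only [hJ, Finset.mem_filter, Finset.mem_univ, true_and,
                       Finset.mem_compl]
                     exact ⟨e, heA, he⟩)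
  simp only [hiff]
  rw [subsetExp_disjoint]
  simp only [sub_sub_cancel]
  rw [← Real.exp_sum, Finset.sum_neg_distrib]
  congr 2
  have h1 : ∑ t ∈ J, pairWeight y t.2 =
      ∑ t : Σ _ : Fin 4, Fin n × Fin n, ∑ e ∈ Aᶜ, if e.val = s(t.2.1, t.2.2) then y e else 0 := by
    rw [hJ, Finset.sum_filter]
    refine Finset.sum_congr rfl fun t _ => ?_
    split_ifs with h
    · obtain ⟨e, heA, he⟩ := h
      rw [pairWeight_eq y he, Finset.sum_eq_single_of_mem e heA, if_pos he]
      intro e' _ hne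
      rw [if_neg]
      intro h'
      exact hne (Subtype.ext (h'.trans he.symm))
    · exact (Finset.sum_eq_zero fun e he => if_neg fun h' => h ⟨e, he, h'⟩).symm
  rw [h1, Finset.sum_comm, Finset.mul_sum]
  refine Finset.sum_congr rfl fun e _ => ?_
  rw [Fintype.sum_sigma]
  simp only [← Finset.sum_filter, Finset.sum_const, card_pairs_eq_two, Finset.card_univ,
    Fintype.card_fin, nsmul_eq_mul]
  push_cast
  ring

end Packing

/-! ### Heavy against light edges, and the conclusion -/

section Main

variable {n : ℕ}

/-- From exp θ ≥ 1 + θ, 1 - exp (-θ) ≥ θ/(1 + θ) ≥ θ/2. -/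
lemma half_le_one_sub_exp_neg {θ y : ℝ} (h0 : 0 ≤ θ) (h1 : θ ≤ 1) (h : θ ≤ y) :
    θ / 2 ≤ 1 - Real.exp (-y) := by
  have e1 : Real.exp (-y) ≤ Real.exp (-θ) := Real.exp_le_exp.2 (by linarith)
  have e2 := Real.add_one_le_exp θ
  have e3 : Real.exp (-θ) * Real.exp θ = 1 := by rw [← Real.exp_add]; simp
  have e4 := Real.exp_pos (-θ)
  nlinarith

/-- The edge set `T` contains no square. -/
def NoCycle (T : Finset (Edge n)) : Prop :=
  ∀ t : Fin n × Fin n × Fin n × Fin n, DistinctVertices t → ¬ cycleSet t ⊆ T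

lemma NoCycle.exists_notMem {S : Finset (Σ _ : Fin 4, Fin n × Fin n)} (hS : NoCycle (edgeImage S))
    {t : Fin n × Fin n × Fin n × Fin n} (ht : DistinctVertices t) :
    ∃ i, ⟨i, cycleEdges t i⟩ ∉ S := by
  by_contra! h
  refine hS t ht fun e he => ?_
  obtain ⟨i, hi⟩ := mem_cycleSet.1 he
  simp only [edgeImage, Finset.mem_filter, Finset.mem_univ, true_and]
  exact ⟨_, h i, hi⟩

open scoped Classical in
/-- If edges are chosen independently and the edge weight packs enough squares, then a square
is likely to be chosen. -/
lemma subsetExp_noCycle_le (hn : 0 < n) {y : Edge n → ℝ} (hy : ∀ e, 0 ≤ y e)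
    {Λ : Fin n × Fin n × Fin n × Fin n → ℝ} (hΛ0 : ∀ t, 0 ≤ Λ t)
    (hΛd : ∀ t, Λ t ≠ 0 → DistinctVertices t)
    (hΛl : ∀ e, ∑ t, (if e ∈ cycleSet t then Λ t else 0) ≤ y e)
    (hL : 8192 * (n : ℝ) ^ (9 / 8 : ℝ) ≤ ∑ t, Λ t) :
    subsetExp (fun t : Σ _ : Fin 4, Fin n × Fin n => 1 - Real.exp (-pairWeight y t.2))
      (fun S => if NoCycle (edgeImage S) then 1 else 0) ≤ 1 / 6 := by
  have : Nonempty (Fin n) := ⟨⟨0, hn⟩⟩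
  have hn1 : (1 : ℝ) ≤ n := by exact_mod_cast hn
  have hn0 : (0 : ℝ) < n := by linarith
  set a : ℝ := (n : ℝ) ^ (9 / 8 : ℝ) with ha
  set θ : ℝ := (n : ℝ) ^ (-(3 / 8) : ℝ) with hθ
  have hθpos : 0 < θ := Real.rpow_pos_of_pos hn0 _
  have hapos : 0 < a := Real.rpow_pos_of_pos hn0 _
  have hθ1 : θ ≤ 1 := Real.rpow_le_one_of_one_le_of_nonpos hn1 (by norm_num)
  have hna : (n : ℝ) ≤ a := Real.self_le_rpow_of_one_le hn1 (by norm_num)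
  have hθa : θ ^ 3 * a = 1 := by
    rw [hθ, ha, ← Real.rpow_natCast, ← Real.rpow_mul hn0.le, ← Real.rpow_add hn0]
    norm_num
  have hna2 : (n : ℝ) ^ 3 * θ ^ 2 = a ^ 2 := by
    rw [hθ, ha, ← Real.rpow_natCast, ← Real.rpow_natCast, ← Real.rpow_natCast,
      ← Real.rpow_mul hn0.le, ← Real.rpow_mul hn0.le, ← Real.rpow_add hn0]
    norm_num
  set z : Fin n × Fin n → ℝ := pairWeight y with hz
  have hz0 : ∀ f, 0 ≤ z f := pairWeight_nonneg hy
  have hload := sum_load_le hy hΛ0 hΛd hΛl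
  set L := ∑ t, Λ t with hLdef
  set Λh : Fin n × Fin n × Fin n × Fin n → ℝ :=
    fun t => if ∀ i, θ < z (cycleEdges t i) then Λ t else 0 with hΛh
  have hΛhle : ∀ t, Λh t ≤ Λ t := fun t => by
    simp only [hΛh]; split_ifs
    · exact le_rfl
    · exact hΛ0 t
  have hΛh0 : ∀ t, 0 ≤ Λh t := fun t => by
    simp only [hΛh]; split_ifs
    · exact hΛ0 t
    · exact le_rfl
  rcases le_or_gt (L / 2) (∑ t, Λh t) with hheavy | hlight
  · have hne : ∀ t, Λh t ≠ 0 → Λ t ≠ 0 ∧ ∀ i, θ < z (cycleEdges t i) := fun t ht => by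
      simp only [hΛh, ne_eq, ite_eq_right_iff, not_forall] at ht
      exact ⟨ht.2, ht.1⟩
    have key := coloured_packing hz0 cycleEdges Λh hΛh0
      (fun i e => (Finset.sum_le_sum fun t _ => by
        split_ifs
        · exact hΛhle t
        · exact le_rfl).trans (hload i e))
      (B := 2 / θ) (by rw [le_div_iff₀ hθpos]; linarith)
      (fun t ht i => by
        rw [inv_div]
        exact half_le_one_sub_exp_neg hθpos.le hθ1 ((hne t ht).2 i).le)
      (fun S => NoCycle (edgeImage S)) (fun S hS t ht => hS.exists_notMem (hΛd t (hne t ht).1))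
    set H := ∑ t, Λh t with hH
    have hHpos : 0 < H := by linarith
    -- The failure probability is then at most 32a/H, with H ≥ L/2 ≥ 4096a.
    have hB : (2 / θ) ^ 3 = 8 * a := by
      rw [div_pow, div_eq_iff (by positivity)]
      linear_combination (-8) * hθa
    rw [hB] at key
    refine le_of_mul_le_mul_right (key.trans ?_) (pow_pos hHpos 2)
    nlinarith
  · set R : Fin n → Fin n → Prop := fun u v => u ≠ v ∧ z (u, v) ≤ θ with hR
    have hp0 : ∀ f, 0 ≤ 1 - Real.exp (-z f) := fun f => by
      have : Real.exp (-z f) ≤ 1 := Real.exp_le_one_iff.2 (by linarith [hz0 f])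
      linarith
    have hp1 : ∀ f, 1 - Real.exp (-z f) ≤ 1 := fun f => by linarith [Real.exp_pos (-z f)]
    have hpz : ∀ f, 1 - Real.exp (-z f) ≤ z f := fun f => by
      linarith [Real.add_one_le_exp (-z f)]
    have hzs : ∀ u v, z (u, v) = z (v, u) := pairWeight_comm y
    -- Half of L sits on squares with a light edge; a factor 4 is lost over its place and 2 in
    -- passing from z to 1 - exp (-z).
    have hT : L / 16 ≤ ∑ u, ∑ v, if R u v then 1 - Real.exp (-z (u, v)) else 0 := by
      have h1 : L / 2 ≤ ∑ t, (Λ t - Λh t) := by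
        rw [Finset.sum_sub_distrib]; linarith
      have h2 : ∀ t, Λ t - Λh t ≤
          ∑ i, if R (cycleEdges t i).1 (cycleEdges t i).2 then Λ t else 0 := by
        intro t
        have hnn : ∀ i : Fin 4, 0 ≤
            if R (cycleEdges t i).1 (cycleEdges t i).2 then Λ t else 0 := fun i => by
          split_ifs
          · exact hΛ0 t
          · exact le_rfl
        simp only [hΛh]
        split_ifs with h
        · rw [sub_self]
          exact Finset.sum_nonneg fun i _ => hnn i
        · rw [sub_zero]
          push Not at h
          obtain ⟨i, hi⟩ := h
          by_cases ht : Λ t = 0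
          · rw [ht]; simp
          · refine le_trans ?_ (Finset.single_le_sum (fun i _ => hnn i) (Finset.mem_univ i))
            rw [if_pos ⟨cycleEdges_ne (hΛd t ht) i, hi⟩]
      have h3 : ∀ i : Fin 4, ∑ t, (if R (cycleEdges t i).1 (cycleEdges t i).2 then Λ t else 0) ≤
          ∑ f : Fin n × Fin n, if R f.1 f.2 then z f else 0 := by
        intro i
        have e : ∀ t, (if R (cycleEdges t i).1 (cycleEdges t i).2 then Λ t else 0) =
            ∑ f : Fin n × Fin n, if cycleEdges t i = f then (if R f.1 f.2 then Λ t else 0)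
              else 0 := fun t => by
          rw [Finset.sum_ite_eq, if_pos (Finset.mem_univ _)]
        simp_rw [e]
        rw [Finset.sum_comm]
        refine Finset.sum_le_sum fun f _ => ?_
        by_cases hf : R f.1 f.2
        · simp only [hf, if_true]
          exact hload i f
        · simp [hf]
      have h4 : ∀ u v, (if R u v then z (u, v) else 0) ≤
          2 * if R u v then 1 - Real.exp (-z (u, v)) else 0 := by
        intro u v
        split_ifs with h
        · have := half_le_one_sub_exp_neg (hz0 (u, v)) (h.2.trans hθ1) le_rfl
          linarith
        · simp
      have h5 : ∑ t, (Λ t - Λh t) ≤ 4 * ∑ f : Fin n × Fin n, if R f.1 f.2 then z f else 0 := by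
        refine (Finset.sum_le_sum fun t _ => h2 t).trans ?_
        rw [Finset.sum_comm]
        refine (Finset.sum_le_sum fun i _ => h3 i).trans_eq ?_
        simp
      have h6 : ∑ f : Fin n × Fin n, (if R f.1 f.2 then z f else 0) ≤
          2 * ∑ u, ∑ v, if R u v then 1 - Real.exp (-z (u, v)) else 0 := by
        rw [Fintype.sum_prod_type]
        simp_rw [Finset.mul_sum]
        exact Finset.sum_le_sum fun u _ => Finset.sum_le_sum fun v _ => h4 u v
      linarith
    refine coloured_light hp0 hp1 (fun u v => by rw [hzs]) R
      (fun u v h => ⟨h.1.symm, by rw [hzs]; exact h.2⟩) hθpos.le hθ1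
      (fun u v h => (hpz _).trans h.2) rfl ?_ ?_ (fun S => NoCycle (edgeImage S))
      (fun S hS b c d e h1 h2 h3 h4 hbd hce => hS.exists_notMem
        (t := (b, c, d, e)) ⟨h1.1, hbd, h4.1.symm, h2.1, hce, h3.1⟩)
    · rw [Fintype.card_fin]; linarith
    · rw [Fintype.card_fin, mul_assoc, hna2]
      nlinarith

open scoped Classical in
lemma real_compl_squareSampled {μ : Measure (Edge n)} [IsProbabilityMeasure μ] (m : ℕ) :
    (Measure.pi fun _ : Fin m => μ).real (squareSampled n m)ᶜ =
      sampleProb (fun e => μ.real {e}) NoCycle m := by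
  have hset : (squareSampled n m)ᶜ =
      ((Finset.univ.filter fun x : Fin m → Edge n => NoCycle (Finset.univ.image x) :
        Finset (Fin m → Edge n)) : Set (Fin m → Edge n)) := by
    ext x
    rw [Finset.mem_coe, Finset.mem_filter, and_iff_right (Finset.mem_univ x)]
    simp only [squareSampled, Set.mem_compl_iff, Set.mem_ofPred_eq, not_exists, not_and, NoCycle]
    have hc : ∀ t, (cycleSet t : Set (Edge n)) ⊆ Set.range x ↔
        cycleSet t ⊆ Finset.univ.image x := fun t => by
      rw [← Finset.coe_subset, Finset.coe_image, Finset.coe_univ, Set.image_univ]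
    constructor
    · exact fun h t ht hsub => h _ (coe_cycleSet_mem_squares ht) ((hc t).2 hsub)
    · intro h Q hQ hsub
      obtain ⟨t, ht, rfl⟩ := exists_cycleSet_eq hQ
      exact h t ht ((hc t).1 hsub)
  rw [hset, ← sum_measureReal_singleton, sampleProb, Finset.sum_filter]
  refine Finset.sum_congr rfl fun x _ => ?_
  congr 1
  rw [measureReal_def, Measure.pi_singleton, ENNReal.toReal_prod]
  rfl

end Main

end EdgeDist

theorem theorem13 :
    ∃ C : ℝ, 0 < C ∧
      ∀ (n : ℕ), 0 < n →
      ∀ (ε : ℝ), 0 < ε → ε < 1 →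
      ∀ (μ : Measure (EdgeDist.Edge n)), IsProbabilityMeasure μ →
        EdgeDist.FarFromSquareFree ε μ →
      ∀ (m : ℕ), C * (n : ℝ) ^ (9 / 8 : ℝ) / ε ≤ (m : ℝ) →
        (2 / 3 : ℝ) ≤
          (Measure.pi (fun _ : Fin m => μ)).real (EdgeDist.squareSampled n m) := by
  classical
  -- 524288 = 64 · 8192, since the packing has total at least (m/16) ε / 4.
  refine ⟨524288, by norm_num, fun n hn ε hε _ μ hμ hfar m hm => ?_⟩
  have hn0 : (0 : ℝ) < n := by exact_mod_cast hn
  have hapos : 0 < (n : ℝ) ^ (9 / 8 : ℝ) := Real.rpow_pos_of_pos hn0 _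
  have hmpos : (0 : ℝ) < m := lt_of_lt_of_le (by positivity) hm
  rw [div_le_iff₀ hε] at hm
  set wt : EdgeDist.Edge n → ℝ := fun e => μ.real {e} with hwt
  have hwt0 : ∀ e, 0 ≤ wt e := fun e => measureReal_nonneg
  have hwt1 : ∑ e, wt e = 1 := by
    simp only [hwt]
    rw [sum_measureReal_singleton, Finset.coe_univ, probReal_univ]
  -- Eight copies of intensity m/16 add up to the Poisson mean m/2.
  set y : EdgeDist.Edge n → ℝ := fun e => m / 16 * wt e with hy
  have hy0 : ∀ e, 0 ≤ y e := fun e => mul_nonneg (by positivity) (hwt0 e)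
  obtain ⟨Λ, hΛ0, hΛd, hΛl, s, hs, hsum⟩ := EdgeDist.exists_packing y hy0
  have hmass : ε ≤ ∑ e ∈ sᶜ, wt e := by
    have := hfar _ hs
    rwa [← Finset.coe_compl, ← sum_measureReal_singleton] at this
  have hL : 8192 * (n : ℝ) ^ (9 / 8 : ℝ) ≤ ∑ t, Λ t := by
    have h1 : ∑ e ∈ sᶜ, y e = m / 16 * ∑ e ∈ sᶜ, wt e := (Finset.mul_sum _ _ _).symm
    have h2 : (m : ℝ) / 16 * ε ≤ m / 16 * ∑ e ∈ sᶜ, wt e :=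
      mul_le_mul_of_nonneg_left hmass (by positivity)
    linarith
  have hind := EdgeDist.subsetExp_noCycle_le hn hy0 hΛ0 hΛd hΛl hL
  set p : (Σ _ : Fin 4, Fin n × Fin n) → ℝ :=
    fun t => 1 - Real.exp (-EdgeDist.pairWeight y t.2) with hp
  -- The law of the uncoloured edge set. Its failure probability is at most 1/6, hence at most 1/3
  -- for m samples.
  set ρ : Finset (EdgeDist.Edge n) → ℝ :=
    fun T => ∑ S, if EdgeDist.edgeImage S = T then EdgeDist.subsetWeight p S else 0 with hρ
  have hcont : ∀ A : Finset (EdgeDist.Edge n), ∑ T ∈ A.powerset, ρ T =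
      Real.exp (-((m / 2 : ℝ) * ∑ e ∈ Aᶜ, wt e)) := fun A => by
    have h := EdgeDist.subsetExp_edgeImage_subset y A
    simp only [hρ]
    rw [EdgeDist.sum_fiber]
    simp only [Finset.mem_powerset]
    simp only [EdgeDist.subsetExp, mul_ite, mul_one, mul_zero] at h
    rw [h, hy, ← Finset.mul_sum]
    congr 2
    ring
  have hpois := EdgeDist.sampleProb_le_two_mul hwt0 hwt1 (by exact_mod_cast hmpos) ρ hcont
    EdgeDist.NoCycle (fun S T hST hT t ht hsub => hT t ht (hsub.trans hST))
  have hρF : ∑ T, (if EdgeDist.NoCycle T then ρ T else 0) =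
      EdgeDist.subsetExp p (fun S => if EdgeDist.NoCycle (EdgeDist.edgeImage S) then 1 else 0) := by
    rw [← Finset.sum_filter, hρ, EdgeDist.sum_fiber]
    simp [EdgeDist.subsetExp]
  rw [hρF, ← EdgeDist.real_compl_squareSampled] at hpois
  have hcompl := probReal_compl_eq_one_sub (μ := Measure.pi fun _ : Fin m => μ)
    (s := EdgeDist.squareSampled n m) (Set.toFinite _).measurableSet
  linarith
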